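/- Let $s=\sigma+i\tau$, let $\Lambda$ be the von Mangoldt function, and let $\rho$ run over the nontrivial zeros of the Riemann zeta function (the zeros with $0<\operatorname{Re}\rho<1$), counted with multiplicity. For $\sigma>\tfrac12$ the series $D_0(s)=\sum_{k=1}^{\infty}\Lambda(k)^2k^{-2s}$ converges absolutely and $$D_0(s)=\frac12\,\frac{d}{ds}\left\{\frac{\zeta'(2s)}{\zeta(2s)}-\frac12\,\frac{\zeta'(4s)}{\zeta(4s)}\right\}+H_0(s),$$ where $H_0$ has an analytic continuation to the half-plane $\{\sigma>\tfrac16\}$. Moreover, $D_0$ has a meromorphic continuation to $\{\sigma>\tfrac16\}$, again denoted by $D_0$, which is holomorphic there except possibly at the points $\tfrac12$, $\tfrac14$, $\rho/2$, $\rho/4$; at every other point $s$ of this half-plane $$D_0(s)=\frac{1}{(2s-1)^2}-\frac{1}{(4s-1)^2}-\sum_\rho\left\{\frac{1}{(2s-\rho)^2}-\frac{1}{(4s-\rho)^2}\right\}+H_1(s),$$ where the sum over $\rho$ converges absolutely and $H_1$ is holomorphic for $\sigma>\tfrac16$. -/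

import Mathlib

/-- The nontrivial ("complex") zeros of the Riemann zeta function: those in the open critical
strip. -/
def nontrivialZetaZeros : Set ℂ :=
  {ρ : ℂ | riemannZeta ρ = 0 ∧ 0 < ρ.re ∧ ρ.re < 1}

/-- The multiplicity of `ρ` as a zero of the Riemann zeta function. -/
noncomputable def zetaZeroMult (ρ : ℂ) : ℕ :=
  analyticOrderNatAt riemannZeta ρ

/-- The general term `Λ(k)² k^{-2s}`; the term with `k = 0` is zero because `Λ 0 = 0`. -/
noncomputable def vonMangoldtSqTerm (s : ℂ) (k : ℕ) : ℂ :=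
  ((ArithmeticFunction.vonMangoldt k : ℝ) : ℂ) ^ 2 / (k : ℂ) ^ (2 * s)

/-- The Dirichlet series `D₀(s) = ∑_{k ≥ 1} Λ(k)² k^{-2s}`. -/
noncomputable def vonMangoldtSqSeries (s : ℂ) : ℂ :=
  ∑' k : ℕ, vonMangoldtSqTerm s k

/-- The summand belonging to a nontrivial zero `ρ`, counted with its multiplicity. -/
noncomputable def zetaZeroTerm (s : ℂ) (ρ : nontrivialZetaZeros) : ℂ :=
  (zetaZeroMult (ρ : ℂ) : ℂ) * (1 / (2 * s - (ρ : ℂ)) ^ 2 - 1 / (4 * s - (ρ : ℂ)) ^ 2)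

/-!
Write `G = (ζ'/ζ)'`. For `Re s > 1/2` both `D₀(s)` and `G(2s) - G(4s)` are Dirichlet series in
`n^(-2s)`. At `n = p^m` the first has the coefficient `log² p`, the second `m log² p` for odd `m`
and `(m/2) log² p` for even `m`, so they agree for `m = 1, 2`. The difference `H₀` is therefore
carried by prime powers with `m ≥ 3` and converges absolutely for `Re 2s > 1/3`
(`LSeriesSummable_remainderCoeff`, `vonMangoldtSq_hasSum`). Hence `D(s) = G(2s) - G(4s) + H₀(s)`
is the continuation, and everything reduces to the singularities of `G` in the right half-plane.

There `(s - 1) ζ(s) = ξ(s) · g(s)` with `ξ` (`entireXi`) entire and `g` (`xiFactor`) analytic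
without zeros, so `G(w) = 1/(w - 1)² + (ξ'/ξ)'(w) + (g'/g)'(w)`, and the poles of `(ξ'/ξ)'` are
the double poles `-m_ρ/(w - ρ)²`. As the remainder only has to be analytic, no Hadamard product is
required: it suffices that `∑ m_ρ/(w - ρ)²` converges, and then its local principal parts cancel
those of `(ξ'/ξ)'` (`exists_deriv_logDeriv_riemannZeta_expansion`).

Convergence follows from Jensen's inequality for `ξ` on discs about `0` (`sum_zetaZeroMult_le`).
The growth of `ξ` is controlled by writing it as a Mellin transform of a nonnegative kernel, which
bounds it on a strip by its values at real even integers, that is, by factorials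
(`norm_completedRiemannZeta₀_le`, `norm_completedRiemannZeta₀_two_mul_le`). With `O(M^(3/2))`
zeros of modulus at most `M`, the sum of `m_ρ/(1 + |ρ|)²` is finite (`summable_zetaZeroMult_div`).
-/

/-! ### Growth of the completed zeta function -/

section CompletedZetaGrowth

open Complex Set MeasureTheory HurwitzZeta Filter

lemma evenKernel_zero_ge_one {t : ℝ} (ht : 0 < t) : 1 ≤ evenKernel 0 t := by
  have h := hasSum_int_evenKernel₀ 0 ht
  have := h.nonneg (fun n ↦ by split_ifs <;> positivity)
  simpa using this

/-- The kernel whose Mellin transform is `completedRiemannZeta₀` takes nonnegative real values: on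
`t > 1` it is `θ(t) - 1`, and on `t < 1` it is `t^(-1/2) (θ(1/t) - 1)` by the functional equation.
-/
lemma ofReal_norm_hurwitzEvenFEPair_f_modif {t : ℝ} (ht : 0 < t) :
    ((‖(hurwitzEvenFEPair 0).f_modif t‖ : ℝ) : ℂ) = (hurwitzEvenFEPair 0).f_modif t := by
  rcases lt_trichotomy t 1 with h | h | h
  · have hfe : evenKernel 0 t - t ^ (-(1 / 2) : ℝ) =
        t ^ (-(1 / 2) : ℝ) * (evenKernel 0 (1 / t) - 1) := by
      rw [evenKernel_functional_equation, evenKernel_eq_cosKernel_of_zero, Real.rpow_neg ht.le]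
      ring
    have h1 := evenKernel_zero_ge_one (one_div_pos.2 ht)
    have : (hurwitzEvenFEPair 0).f_modif t = ((evenKernel 0 t - t ^ (-(1 / 2) : ℝ) : ℝ) : ℂ) := by
      rw [WeakFEPair.f_modif, Pi.add_apply, indicator_of_notMem (by simpa using h.le),
        indicator_of_mem (s := Ioo 0 1) ⟨ht, h⟩]
      simp [hurwitzEvenFEPair]
    rw [this, hfe, Complex.norm_of_nonneg]
    have := Real.rpow_nonneg ht.le (-(1 / 2) : ℝ)
    exact mul_nonneg this (by linarith)
  · subst h; simp [WeakFEPair.f_modif]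
  · have h1 := evenKernel_zero_ge_one ht
    have : (hurwitzEvenFEPair 0).f_modif t = ((evenKernel 0 t - 1 : ℝ) : ℂ) := by
      rw [WeakFEPair.f_modif, Pi.add_apply, indicator_of_notMem (s := Ioo 0 1) (by simp [h.le]),
        indicator_of_mem (by simpa using h)]
      simp [hurwitzEvenFEPair]
    rw [this, Complex.norm_of_nonneg (by linarith)]

/-- As a Mellin transform of a nonnegative kernel, `completedRiemannZeta₀` is dominated on a
vertical strip by its values at two real points to either side; `1 - 2N` and `2N` give the same
value by the functional equation. -/
lemma norm_completedRiemannZeta₀_le {N : ℕ} {s : ℂ} (h1 : 1 - 2 * (N : ℝ) ≤ s.re)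
    (h2 : s.re ≤ 2 * N) :
    ‖completedRiemannZeta₀ s‖ ≤ 2 * ‖completedRiemannZeta₀ (2 * N)‖ := by
  set P := hurwitzEvenFEPair 0
  set φ : ℝ → ℝ := fun t ↦ ‖P.f_modif t‖
  have conv (z : ℂ) : MellinConvergent P.f_modif z :=
    (P.isStrongFEPair_toStrongFEPair.hasMellin z).1
  have intg (x : ℝ) : IntegrableOn (fun t : ℝ ↦ t ^ (x - 1) * φ t) (Ioi 0) := by
    refine IntegrableOn.congr_fun (Integrable.norm (conv x)) (fun t ht ↦ ?_) measurableSet_Ioi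
    have ht : 0 < t := ht
    simp [norm_cpow_eq_rpow_re_of_pos ht, φ]
  have real (x : ℝ) : P.Λ₀ x = ((∫ t in Ioi (0 : ℝ), t ^ (x - 1) * φ t : ℝ) : ℂ) := by
    rw [WeakFEPair.Λ₀, mellin, ← integral_complex_ofReal]
    refine setIntegral_congr_fun measurableSet_Ioi (fun t ht ↦ ?_)
    have ht : 0 < t := ht
    simp only [smul_eq_mul, ofReal_mul, φ, P, ofReal_norm_hurwitzEvenFEPair_f_modif ht,
      ofReal_cpow ht.le]
    simp
  have nn (x : ℝ) : ‖P.Λ₀ x‖ = ∫ t in Ioi (0 : ℝ), t ^ (x - 1) * φ t := by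
    rw [real, Complex.norm_of_nonneg]
    refine setIntegral_nonneg measurableSet_Ioi (fun t ht ↦ ?_)
    exact mul_nonneg (Real.rpow_nonneg (le_of_lt ht) _) (norm_nonneg _)
  have key : ‖P.Λ₀ (s / 2)‖ ≤ ‖P.Λ₀ ((N : ℝ) : ℂ)‖ + ‖P.Λ₀ ((1 / 2 - N : ℝ) : ℂ)‖ := by
    rw [nn, nn, ← integral_add (intg _) (intg _), WeakFEPair.Λ₀, mellin]
    refine norm_integral_le_of_norm_le ((intg _).add (intg _)) ?_
    filter_upwards [ae_restrict_mem measurableSet_Ioi] with t ht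
    have ht : 0 < t := ht
    rw [norm_smul, norm_cpow_eq_rpow_re_of_pos ht, ← add_mul]
    refine mul_le_mul_of_nonneg_right ?_ (norm_nonneg _)
    have hre : (s / 2 - 1).re = s.re / 2 - 1 := by simp
    rw [hre]
    rcases le_total 1 t with h | h
    · exact (Real.rpow_le_rpow_of_exponent_le h (by linarith)).trans
        (le_add_of_nonneg_right (Real.rpow_nonneg ht.le _))
    · exact (Real.rpow_le_rpow_of_exponent_ge ht h (by linarith)).trans
        (le_add_of_nonneg_left (Real.rpow_nonneg ht.le _))
  have e0 (z : ℂ) : completedRiemannZeta₀ z = P.Λ₀ (z / 2) / 2 := rfl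
  have e1 : completedRiemannZeta₀ (2 * N) = P.Λ₀ ((N : ℝ) : ℂ) / 2 := by
    rw [e0]; congr 2; push_cast; ring
  have e2 : completedRiemannZeta₀ (2 * N) = P.Λ₀ ((1 / 2 - N : ℝ) : ℂ) / 2 := by
    rw [← completedRiemannZeta₀_one_sub, e0]; congr 2; push_cast; ring
  have e1' := congrArg norm e1
  have e2' := congrArg norm e2
  rw [e0 s]
  simp only [norm_div, norm_ofNat] at *
  linarith

/-- At `2(M + 1)` the Gamma factor is `M!`, and every other factor is bounded. -/
lemma norm_completedRiemannZeta₀_two_mul_le : ∃ C : ℝ, 0 ≤ C ∧ ∀ M : ℕ,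
    ‖completedRiemannZeta₀ (2 * (M + 1 : ℕ))‖ ≤ C * M.factorial := by
  refine ⟨∑' n : ℕ, 1 / (n : ℝ) ^ 2 + 2, by positivity, fun M ↦ ?_⟩
  have hM : (1 : ℝ) ≤ M.factorial := mod_cast Nat.one_le_iff_ne_zero.2 (Nat.factorial_ne_zero _)
  set z : ℂ := 2 * (M + 1 : ℕ) with hz
  have hzr : z = ((2 * (M + 1) : ℕ) : ℂ) := by rw [hz]; push_cast; ring
  have hre : z.re = 2 * (M + 1) := by rw [hzr]; simp
  have hM0 : (0 : ℝ) ≤ M := by positivity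
  have h1 : 1 < z.re := by rw [hre]; linarith
  have e : completedRiemannZeta₀ z = completedRiemannZeta z + 1 / z + 1 / (1 - z) := by
    rw [completedRiemannZeta_eq]; ring
  have b1 : ‖1 / z‖ ≤ 1 := by
    rw [norm_div, norm_one]
    exact div_le_one_of_le₀ (h1.le.trans (re_le_norm z)) (norm_nonneg _)
  have b2 : ‖1 / (1 - z)‖ ≤ 1 := by
    rw [norm_div, norm_one]
    refine div_le_one_of_le₀ ?_ (norm_nonneg _)
    rw [norm_sub_rev]
    refine le_trans ?_ (re_le_norm _)
    simp [hre]; linarith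
  have b3 : ‖completedRiemannZeta z‖ ≤ M.factorial * ∑' n : ℕ, 1 / (n : ℝ) ^ 2 := by
    rw [completedZeta_eq_tsum_of_one_lt_re h1, norm_mul, norm_mul]
    have g1 : ‖(Real.pi : ℂ) ^ (-z / 2)‖ ≤ 1 := by
      rw [norm_cpow_eq_rpow_re_of_pos Real.pi_pos]
      refine Real.rpow_le_one_of_one_le_of_nonpos (by linarith [Real.pi_gt_three]) ?_
      simp [hre]; linarith
    have g2 : ‖Gamma (z / 2)‖ = M.factorial := by
      have : z / 2 = (M : ℂ) + 1 := by rw [hz]; push_cast; ring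
      rw [this, Gamma_nat_eq_factorial]; simp
    have g3 : ‖∑' n : ℕ, 1 / (n : ℂ) ^ z‖ ≤ ∑' n : ℕ, 1 / (n : ℝ) ^ 2 := by
      refine tsum_of_norm_bounded (Real.summable_one_div_nat_pow.2 (by norm_num)).hasSum fun n ↦ ?_
      rcases Nat.eq_zero_or_pos n with rfl | hn
      · rw [Nat.cast_zero, zero_cpow (ne_zero_of_one_lt_re h1)]; simp
      rw [norm_div, norm_one, norm_natCast_cpow_of_pos hn, ← Real.rpow_natCast]
      refine one_div_le_one_div_of_le (by positivity) ?_
      refine Real.rpow_le_rpow_of_exponent_le (mod_cast hn) ?_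
      rw [hre]; push_cast; linarith
    rw [g2]
    calc _ ≤ 1 * (M.factorial : ℝ) * ∑' n : ℕ, 1 / (n : ℝ) ^ 2 := by gcongr
      _ = _ := by ring
  rw [e]
  calc _ ≤ ‖completedRiemannZeta z‖ + ‖1 / z‖ + ‖1 / (1 - z)‖ := norm_add₃_le
    _ ≤ _ := by nlinarith

end CompletedZetaGrowth

/-! ### Counting the nontrivial zeros -/

section ZeroCounting

open Complex Set Filter Topology MeromorphicOn Metric

/-- The entire function `s (1 - s) Λ(s)`, where `Λ` is the completed zeta function. It is written
through `completedRiemannZeta₀` so that the formula also holds at `s = 0` and `s = 1`. In the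
right half-plane its zeros are the nontrivial zeros of `ζ`, with the same multiplicities. -/
noncomputable def entireXi (s : ℂ) : ℂ := s * (1 - s) * completedRiemannZeta₀ s - 1

lemma differentiable_entireXi : Differentiable ℂ entireXi :=
  ((differentiable_id.mul (differentiable_id.const_sub 1)).mul
    differentiable_completedZeta₀).sub_const 1

lemma entireXi_zero : entireXi 0 = -1 := by simp [entireXi]

lemma entireXi_one : entireXi 1 = -1 := by simp [entireXi]

/-- The factor `-1 / (s Γ_ℝ(s))`, analytic and nonvanishing for `0 < Re s`, with
`(s - 1) ζ(s) = entireXi s * xiFactor s`. -/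
noncomputable def xiFactor (s : ℂ) : ℂ := -(s * Gammaℝ s)⁻¹

lemma analyticAt_xiFactor {s : ℂ} (hs : 0 < s.re) : AnalyticAt ℂ xiFactor s := by
  have h0 : s ≠ 0 := fun h ↦ by simp [h] at hs
  have : xiFactor = fun s ↦ -(s⁻¹ * (Gammaℝ s)⁻¹) := by
    funext s; simp [xiFactor, mul_comm]
  rw [this]
  exact ((analyticAt_id.inv h0).mul (differentiable_Gammaℝ_inv.analyticAt s)).neg

lemma xiFactor_ne_zero {s : ℂ} (hs : 0 < s.re) : xiFactor s ≠ 0 := by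
  have h0 : s ≠ 0 := fun h ↦ by simp [h] at hs
  exact neg_ne_zero.2 (inv_ne_zero (mul_ne_zero h0 (Gammaℝ_ne_zero_of_re_pos hs)))

lemma riemannZeta_eq_entireXi_mul {s : ℂ} (hs : 0 < s.re) (h1 : s ≠ 1) :
    riemannZeta s = entireXi s * (xiFactor s / (s - 1)) := by
  have h0 : s ≠ 0 := fun h ↦ by simp [h] at hs
  have h1' : 1 - s ≠ 0 := sub_ne_zero.2 h1.symm
  have h1'' : s - 1 ≠ 0 := sub_ne_zero.2 h1
  have hG := Gammaℝ_ne_zero_of_re_pos hs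
  have : 1 / (1 - s) = - (1 / (s - 1)) := by rw [← neg_sub s 1, div_neg]
  rw [riemannZeta_def_of_ne_zero h0, completedRiemannZeta_eq, entireXi, xiFactor, this]
  field_simp
  ring

lemma isOpen_re_pos : IsOpen {s : ℂ | 0 < s.re} := isOpen_lt continuous_const continuous_re

/-- The value at `1` causes no exception: `ζ` has no zero there, and neither does `entireXi`. -/
lemma zetaZeroMult_eq {ρ : ℂ} (hρ : 0 < ρ.re) :
    zetaZeroMult ρ = analyticOrderNatAt entireXi ρ := by
  rcases eq_or_ne ρ 1 with rfl | h1
  · have e1 : analyticOrderAt entireXi 1 = 0 := by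
      rw [(differentiable_entireXi.analyticAt 1).analyticOrderAt_eq_zero, entireXi_one]
      simp
    have e2 : analyticOrderAt riemannZeta 1 = 0 := by
      by_cases h : AnalyticAt ℂ riemannZeta 1
      · exact h.analyticOrderAt_eq_zero.2 riemannZeta_one_ne_zero
      · exact analyticOrderAt_of_not_analyticAt h
    rw [zetaZeroMult, analyticOrderNatAt, analyticOrderNatAt, e1, e2]
  · have ha : AnalyticAt ℂ (fun s ↦ xiFactor s / (s - 1)) ρ :=
      (analyticAt_xiFactor hρ).div (analyticAt_id.sub analyticAt_const) (sub_ne_zero.2 h1)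
    have hev : riemannZeta =ᶠ[𝓝 ρ] entireXi * (fun s ↦ xiFactor s / (s - 1)) := by
      filter_upwards [isOpen_re_pos.mem_nhds hρ, isOpen_ne.mem_nhds h1] with s hs hs1
      exact riemannZeta_eq_entireXi_mul hs hs1
    rw [zetaZeroMult, analyticOrderNatAt, analyticOrderNatAt, analyticOrderAt_congr hev,
      analyticOrderAt_mul (differentiable_entireXi.analyticAt ρ) ha, ha.analyticOrderAt_eq_zero.2,
      add_zero]
    exact div_ne_zero (xiFactor_ne_zero hρ) (sub_ne_zero.2 h1)

/-- The function `entireXi` has order at most `3 / 2`: on the circle of radius `2M` the logarithm of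
its modulus is `O(M^(3/2))`, by `M! ≤ M^M` and `log M ≤ 2 √M`. -/
lemma log_norm_entireXi_bound : ∃ C : ℝ, 0 ≤ C ∧ ∀ M : ℕ, 1 ≤ M → ∃ B : ℝ, 1 ≤ B ∧
    (∀ z : ℂ, ‖z‖ = 2 * M → ‖entireXi z‖ ≤ B) ∧ Real.log B ≤ C * (M : ℝ) ^ (3 / 2 : ℝ) := by
  obtain ⟨C, hC, hb⟩ := norm_completedRiemannZeta₀_two_mul_le
  have hlA : 0 ≤ Real.log (12 * C + 1) := Real.log_nonneg (by linarith)
  refine ⟨Real.log (12 * C + 1) + 6, by positivity, fun M hM ↦ ?_⟩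
  have hM1 : (1 : ℝ) ≤ M := mod_cast hM
  have hfac : (M.factorial : ℝ) ≤ (M : ℝ) ^ M := mod_cast M.factorial_le_pow
  have hone : (1 : ℝ) ≤ (M : ℝ) ^ (M + 2) := one_le_pow₀ hM1
  refine ⟨(12 * C + 1) * (M : ℝ) ^ (M + 2), by nlinarith, fun z hz ↦ ?_, ?_⟩
  · have hre := abs_le.1 (abs_re_le_norm z)
    have h0 : ‖completedRiemannZeta₀ z‖ ≤ 2 * (C * (M : ℝ) ^ M) := by
      refine (norm_completedRiemannZeta₀_le (N := M + 1) ?_ ?_).trans ?_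
      · push_cast; linarith
      · push_cast; linarith
      · exact mul_le_mul_of_nonneg_left ((hb M).trans (by gcongr)) (by norm_num)
    have h1 : ‖1 - z‖ ≤ 3 * M := (norm_sub_le _ _).trans (by rw [hz, norm_one]; linarith)
    calc ‖entireXi z‖ ≤ ‖z‖ * ‖1 - z‖ * ‖completedRiemannZeta₀ z‖ + 1 := by
          refine (norm_sub_le _ _).trans ?_
          simp
      _ ≤ (2 * M) * (3 * M) * (2 * (C * (M : ℝ) ^ M)) + 1 := by rw [hz]; gcongr
      _ = 12 * C * (M : ℝ) ^ (M + 2) + 1 := by ring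
      _ ≤ _ := by linarith
  · have hl : Real.log M ≤ 2 * (M : ℝ) ^ (1 / 2 : ℝ) := by
      have := Real.log_le_rpow_div (x := M) (by positivity) (ε := 1 / 2) (by norm_num)
      linarith
    have hMe : (M : ℝ) ^ (3 / 2 : ℝ) = M * (M : ℝ) ^ (1 / 2 : ℝ) := by
      rw [← Real.rpow_one_add' (by positivity) (by norm_num)]; norm_num
    have h32 : (1 : ℝ) ≤ (M : ℝ) ^ (3 / 2 : ℝ) := Real.one_le_rpow hM1 (by norm_num)
    rw [Real.log_mul (by positivity) (by positivity), Real.log_pow, add_mul]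
    refine add_le_add (le_mul_of_one_le_right hlA h32) ?_
    rw [hMe]
    have h3 : ((M + 2 : ℕ) : ℝ) ≤ 3 * M := by push_cast; linarith
    calc _ ≤ (3 * M : ℝ) * (2 * (M : ℝ) ^ (1 / 2 : ℝ)) :=
          mul_le_mul h3 hl (Real.log_nonneg hM1) (by positivity)
      _ = _ := by ring

/-- Jensen's inequality on the discs of radii `M` and `2M`: at most `O(M^(3/2))` nontrivial zeros,
counted with multiplicity, have modulus at most `M`. -/
lemma sum_zetaZeroMult_le : ∃ C : ℝ, 0 ≤ C ∧ ∀ M : ℕ, 1 ≤ M →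
    ∀ S : Finset nontrivialZetaZeros, (∀ ρ ∈ S, ‖(ρ : ℂ)‖ ≤ M) →
      ∑ ρ ∈ S, (zetaZeroMult ρ : ℝ) ≤ C * (M : ℝ) ^ (3 / 2 : ℝ) := by
  classical
  obtain ⟨C, hC, hb⟩ := log_norm_entireXi_bound
  have hlog2 : 0 < Real.log 2 := Real.log_pos (by norm_num)
  refine ⟨C / Real.log 2, by positivity, fun M hM S hS ↦ ?_⟩
  obtain ⟨B, hB1, hB, hlog⟩ := hb M hM
  have hM1 : (1 : ℝ) ≤ M := mod_cast hM
  have hM2 : |(2 * M : ℝ)| = 2 * M := abs_of_nonneg (by positivity)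
  have hM3 : |(M : ℝ)| = M := abs_of_nonneg (by positivity)
  have han (U : Set ℂ) : AnalyticOnNhd ℂ entireXi U := fun z _ ↦
    differentiable_entireXi.analyticAt z
  have hJ := AnalyticOnNhd.sum_divisor_le (c := 0) (r := M) (R := 2 * M) (M := B) (f := entireXi)
    (by rw [hM3]; linarith) (by rw [hM2, hM3]; linarith) hB1 (han _) (by simp [entireXi_zero])
    (fun z hz ↦ hB z (by simpa [hM2] using hz))
  set D := divisor entireXi (closedBall 0 |(M : ℝ)|) with hD
  have hfin : (Function.support D).Finite := D.finiteSupport (isCompact_closedBall _ _)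
  have hDS : ∑ ρ ∈ S, (zetaZeroMult ρ : ℤ) ≤ ∑ᶠ u, D u := by
    rw [finsum_eq_sum_of_support_subset (s := hfin.toFinset ∪ S.image Subtype.val) D
      (by intro x hx; simp only [Finset.coe_union, Finite.coe_toFinset]; exact Or.inl hx)]
    calc ∑ ρ ∈ S, (zetaZeroMult ρ : ℤ) = ∑ ρ ∈ S.image Subtype.val, D ρ := by
          rw [Finset.sum_image (fun _ _ _ _ h ↦ Subtype.ext h)]
          refine Finset.sum_congr rfl fun ρ hρ ↦ ?_
          rw [hD, (han _).divisor_apply (by simpa [hM3] using hS ρ hρ), zetaZeroMult_eq ρ.2.2.1,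
            analyticOrderNatAt]
          cases analyticOrderAt entireXi (ρ : ℂ) <;> simp
      _ ≤ _ := Finset.sum_le_sum_of_subset_of_nonneg Finset.subset_union_right
          fun x _ _ ↦ (han _).divisor_nonneg x
  have hDS' : ∑ ρ ∈ S, (zetaZeroMult ρ : ℝ) ≤ ((∑ᶠ u, D u : ℤ) : ℝ) := mod_cast hDS
  refine hDS'.trans (hJ.trans ?_)
  have e : (2 * M / M : ℝ) = 2 := by field_simp
  rw [entireXi_zero, norm_neg, norm_one, div_one, e, div_mul_eq_mul_div]
  gcongr

/-- Dyadic summation: if the total weight of the points of size at most `M` is `O(M^(3/2))`, then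
the weights divided by the squared sizes are summable. -/
lemma summable_div_sq_of_counting {ι : Type*} (m a : ι → ℝ) (hm : ∀ i, 0 ≤ m i)
    (ha : ∀ i, 1 ≤ a i) (C : ℝ) (hC : 0 ≤ C)
    (h : ∀ M : ℕ, 1 ≤ M → ∀ S : Finset ι, (∀ i ∈ S, a i ≤ M) →
      ∑ i ∈ S, m i ≤ C * (M : ℝ) ^ (3 / 2 : ℝ)) :
    Summable fun i ↦ m i / a i ^ 2 := by
  classical
  set q : ℝ := (2 : ℝ) ^ (-(1 / 2) : ℝ) with hq
  have hq0 : 0 ≤ q := by positivity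
  have hq1 : q < 1 := Real.rpow_lt_one_of_one_lt_of_neg (by norm_num) (by norm_num)
  have hgeo : Summable fun k : ℕ ↦ C * (2 : ℝ) ^ (3 / 2 : ℝ) * q ^ k :=
    (summable_geometric_of_lt_one hq0 hq1).mul_left _
  refine summable_of_sum_le (c := ∑' k : ℕ, C * (2 : ℝ) ^ (3 / 2 : ℝ) * q ^ k)
    (fun i ↦ div_nonneg (hm i) (sq_nonneg _)) fun S ↦ ?_
  -- the dyadic shell of `i`: `2 ^ κ i ≤ a i ≤ 2 ^ (κ i + 1)`
  set κ : ι → ℕ := fun i ↦ Nat.log 2 ⌊a i⌋₊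
  have lo (i) : (2 : ℝ) ^ κ i ≤ a i := by
    have h0 : ⌊a i⌋₊ ≠ 0 := (Nat.floor_pos.2 (ha i)).ne'
    calc (2 : ℝ) ^ κ i ≤ (⌊a i⌋₊ : ℝ) := mod_cast Nat.pow_log_le_self 2 h0
      _ ≤ a i := Nat.floor_le (by linarith [ha i])
  have hi (i) : a i ≤ ((2 ^ (κ i + 1) : ℕ) : ℝ) := by
    refine (Nat.lt_floor_add_one (a i)).le.trans ?_
    exact_mod_cast Nat.lt_pow_succ_log_self (b := 2) (by norm_num) ⌊a i⌋₊
  calc ∑ i ∈ S, m i / a i ^ 2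
      = ∑ k ∈ S.image κ, ∑ i ∈ S with κ i = k, m i / a i ^ 2 :=
        (Finset.sum_fiberwise_of_maps_to (fun i hi ↦ Finset.mem_image_of_mem _ hi) _).symm
    _ ≤ ∑ k ∈ S.image κ, C * (2 : ℝ) ^ (3 / 2 : ℝ) * q ^ k := by
        refine Finset.sum_le_sum fun k _ ↦ ?_
        have h1 : ∑ i ∈ S with κ i = k, m i ≤ C * ((2 ^ (k + 1) : ℕ) : ℝ) ^ (3 / 2 : ℝ) := by
          refine h _ Nat.one_le_two_pow _ fun i hik ↦ ?_
          rw [← (Finset.mem_filter.1 hik).2]; exact hi i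
        have h2 : ∑ i ∈ S with κ i = k, m i / a i ^ 2 ≤
            ∑ i ∈ S with κ i = k, m i / ((2 : ℝ) ^ k) ^ 2 := by
          refine Finset.sum_le_sum fun i hik ↦ ?_
          have := lo i
          rw [(Finset.mem_filter.1 hik).2] at this
          have := hm i
          gcongr
        rw [← Finset.sum_div] at h2
        refine h2.trans ((div_le_div_of_nonneg_right h1 (by positivity)).trans_eq ?_)
        push_cast
        have e1 : ((2 : ℝ) ^ (k + 1)) ^ (3 / 2 : ℝ) = 2 ^ (3 / 2 : ℝ) * 2 ^ (k * (3 / 2) : ℝ) := by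
          rw [pow_succ', Real.mul_rpow (by norm_num) (by positivity), ← Real.rpow_natCast 2 k,
            ← Real.rpow_mul (by norm_num)]
        have e2 : q ^ k = (2 : ℝ) ^ (k * (3 / 2) : ℝ) / ((2 : ℝ) ^ k) ^ 2 := by
          rw [hq, ← Real.rpow_natCast, ← Real.rpow_natCast 2 k, ← Real.rpow_mul (by norm_num),
            ← Real.rpow_natCast _ 2, ← Real.rpow_mul (by norm_num), ← Real.rpow_sub (by norm_num)]
          congr 1; push_cast; ring
        rw [e1, e2]; ring
    _ ≤ _ := hgeo.sum_le_tsum _ fun k _ ↦ by positivity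

lemma summable_zetaZeroMult_div :
    Summable fun ρ : nontrivialZetaZeros ↦ (zetaZeroMult ρ : ℝ) / (1 + ‖(ρ : ℂ)‖) ^ 2 := by
  obtain ⟨C, hC, h⟩ := sum_zetaZeroMult_le
  exact summable_div_sq_of_counting _ _ (fun _ ↦ by positivity)
    (fun ρ ↦ by linarith [norm_nonneg (ρ : ℂ)]) C hC
    fun M hM S hS ↦ h M hM S fun ρ hρ ↦ by linarith [hS ρ hρ]

end ZeroCounting

/-! ### Principal parts and the sum over the zeros -/

section LocalSingularities

open Complex Set Filter Topology Metric

/-- Removal of singularities on an open set: a function that agrees near every point, the point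
itself excepted, with some function analytic there extends to an analytic function, and the
extension keeps the value wherever the given function is continuous. -/
lemma exists_analytic_extension {V : Set ℂ} {f : ℂ → ℂ}
    (h : ∀ w ∈ V, ∃ g : ℂ → ℂ, AnalyticAt ℂ g w ∧ f =ᶠ[𝓝[≠] w] g) (hV : IsOpen V) :
    ∃ K : ℂ → ℂ, (∀ w ∈ V, AnalyticAt ℂ K w) ∧ ∀ w ∈ V, ContinuousAt f w → K w = f w := by
  classical
  choose! g hg hfg using h
  -- two continuous functions agreeing on a punctured neighbourhood agree at the centre
  have uniq {u v : ℂ → ℂ} {w : ℂ} (hu : ContinuousAt u w) (hv : ContinuousAt v w)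
      (huv : u =ᶠ[𝓝[≠] w] v) : u w = v w :=
    tendsto_nhds_unique_of_eventuallyEq (hu.mono_left nhdsWithin_le_nhds)
      (hv.mono_left nhdsWithin_le_nhds) huv
  refine ⟨fun w ↦ g w w, fun w hw ↦ ?_, fun w hw hf ↦
    (uniq hf (hg w hw).continuousAt (hfg w hw)).symm⟩
  refine (hg w hw).congr ?_
  have h1 := (eventually_eventually_nhdsWithin.2 (hfg w hw))
  rw [eventually_nhdsWithin_iff] at h1
  filter_upwards [h1, (hg w hw).eventually_analyticAt, hV.mem_nhds hw] with z hz hgz hzV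
  rcases eq_or_ne z w with rfl | hzw
  · rfl
  · have h2 : f =ᶠ[𝓝 z] g w := by
      have := hz hzw
      rwa [isOpen_compl_singleton.nhdsWithin_eq hzw] at this
    exact uniq hgz.continuousAt (hg z hzV).continuousAt
      ((h2.symm.filter_mono nhdsWithin_le_nhds).trans (hfg z hzV))

/-- At a zero of order `n` the derivative of the logarithmic derivative has principal part
`-n / (z - w) ^ 2`. -/
lemma deriv_logDeriv_of_analyticOrderNatAt {f : ℂ → ℂ} {w : ℂ} (hf : AnalyticAt ℂ f w)
    (htop : analyticOrderAt f w ≠ ⊤) :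
    ∃ g : ℂ → ℂ, AnalyticAt ℂ g w ∧ ∀ᶠ z in 𝓝[≠] w,
      deriv (logDeriv f) z = -(analyticOrderNatAt f w : ℂ) / (z - w) ^ 2 + g z := by
  set n := analyticOrderNatAt f w
  obtain ⟨g, hg, hg0, hfg⟩ := (hf.analyticOrderAt_ne_top).1 htop
  refine ⟨deriv (logDeriv g), (hg.deriv.div hg hg0).deriv, ?_⟩
  have hgne := hg.continuousAt.eventually_ne hg0
  have h1 : ∀ᶠ z in 𝓝 w, (f =ᶠ[𝓝 z] fun z ↦ (z - w) ^ n * g z) ∧ g z ≠ 0 ∧ AnalyticAt ℂ g z :=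
    (eventually_eventually_nhds.2 (hfg.mono fun z hz ↦ by simpa using hz)).and
      (hgne.and hg.eventually_analyticAt)
  have h2 : ∀ᶠ z in 𝓝[≠] w, logDeriv f z = n / (z - w) + logDeriv g z := by
    filter_upwards [h1.filter_mono nhdsWithin_le_nhds, self_mem_nhdsWithin] with z hz hzw
    obtain ⟨hz1, hz2, hz3⟩ := hz
    have hzw : z - w ≠ 0 := sub_ne_zero.2 hzw
    have e : logDeriv f z = logDeriv (fun z ↦ (z - w) ^ n * g z) z := by
      rw [logDeriv_apply, logDeriv_apply, hz1.deriv_eq, hz1.eq_of_nhds]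
    rw [e, logDeriv_mul (f := fun z ↦ (z - w) ^ n) z (pow_ne_zero n hzw) hz2 (by fun_prop)
      hz3.differentiableAt, logDeriv_fun_pow (f := fun z ↦ z - w) (by fun_prop)]
    congr 1
    rw [logDeriv_apply, deriv_sub_const, deriv_id'']
    ring
  filter_upwards [eventually_eventually_nhdsWithin.2 h2, self_mem_nhdsWithin,
    h1.filter_mono nhdsWithin_le_nhds] with z hz hzw hz1
  rw [isOpen_compl_singleton.nhdsWithin_eq hzw] at hz
  have hzw' : z - w ≠ 0 := sub_ne_zero.2 hzw
  rw [Filter.EventuallyEq.deriv_eq hz]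
  have hd1 : HasDerivAt (fun z ↦ (n : ℂ) / (z - w)) (-(n : ℂ) / (z - w) ^ 2) z := by
    have := (hasDerivAt_const z (n : ℂ)).div ((hasDerivAt_id z).sub_const w) hzw'
    exact this.congr_deriv (by simp)
  have hd2 : DifferentiableAt ℂ (logDeriv g) z :=
    (hz1.2.2.deriv.div hz1.2.2 hz1.2.1).differentiableAt
  exact (hd1.add hd2.hasDerivAt).deriv

/-- The sum of `1 / (w - ρ) ^ 2` over the nontrivial zeros `ρ` of `ζ`, with multiplicity. If `w` is
itself a zero, its own summand is `0`. -/
noncomputable def zetaZeroSquareSum (w : ℂ) : ℂ :=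
  ∑' ρ : nontrivialZetaZeros, (zetaZeroMult ρ : ℂ) * (1 / (w - ρ) ^ 2)

lemma exists_ball_zetaZeros (w : ℂ) :
    ∃ r > 0, ∀ ρ ∈ nontrivialZetaZeros, ρ ≠ w → 2 * r ≤ ‖ρ - w‖ := by
  have hfin := (isCompact_closedBall w 1).inter_riemannZetaZeros_finite
  have hcl : IsClosed ((closedBall w 1 ∩ riemannZetaZeros) \ {w}) :=
    (hfin.subset sdiff_subset).isClosed
  have hw : ((closedBall w 1 ∩ riemannZetaZeros) \ {w})ᶜ ∈ 𝓝 w :=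
    hcl.isOpen_compl.mem_nhds (by simp)
  obtain ⟨ε, hε, hball⟩ := Metric.mem_nhds_iff.1 hw
  refine ⟨min ε 1 / 2, by positivity, fun ρ hρ hne ↦ ?_⟩
  by_contra! hlt
  have hlt' : ‖ρ - w‖ < min ε 1 := by linarith
  refine hball (a := ρ) (by rw [mem_ball, dist_eq_norm]; exact hlt'.trans_le (min_le_left _ _)) ?_
  refine ⟨⟨?_, hρ.1⟩, hne⟩
  rw [mem_closedBall, dist_eq_norm]
  exact hlt'.le.trans (min_le_right _ _)

lemma riemannZeta_ne_zero_of_notMem {w : ℂ} (hw : 0 < w.re) (hw' : w ∉ nontrivialZetaZeros) :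
    riemannZeta w ≠ 0 := fun h ↦ hw' ⟨h, hw, by
  by_contra! h1
  exact riemannZeta_ne_zero_of_one_le_re h1 h⟩

lemma zetaZeroMult_eq_zero {w : ℂ} (hw : 0 < w.re) (hw' : w ∉ nontrivialZetaZeros) :
    zetaZeroMult w = 0 := by
  have h := riemannZeta_ne_zero_of_notMem hw hw'
  contrapose! h
  exact apply_eq_zero_of_analyticOrderNatAt_ne_zero h

/-- Near any `w` in the right half-plane, the sum over the zeros is its principal part at `w`,
which is zero if `w` is not a nontrivial zero, plus an analytic function. -/
lemma zetaZeroSquareSum_local {w : ℂ} (hw0 : 0 < w.re) :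
    ∃ (r : ℝ) (Q : ℂ → ℂ), 0 < r ∧ AnalyticAt ℂ Q w ∧
    ∀ z ∈ ball w r,
      Summable (fun ρ : nontrivialZetaZeros ↦ (zetaZeroMult ρ : ℂ) * (1 / (z - ρ) ^ 2)) ∧
      zetaZeroSquareSum z =
        (zetaZeroMult w : ℂ) * (1 / (z - w) ^ 2) + Q z := by
  classical
  obtain ⟨r, hr, hsep⟩ := exists_ball_zetaZeros w
  set t : nontrivialZetaZeros → ℂ → ℂ := fun ρ z ↦ (zetaZeroMult ρ : ℂ) * (1 / (z - ρ) ^ 2)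
  set q : nontrivialZetaZeros → ℂ → ℂ := fun ρ z ↦ if (ρ : ℂ) = w then 0 else t ρ z with hq
  -- on the ball, `1 + ‖ρ‖ ≤ A * ‖z - ρ‖` for every zero `ρ ≠ w`
  set A : ℝ := (1 + ‖w‖) / r + 2
  have hA : 0 < A := by positivity
  have far (ρ : nontrivialZetaZeros) (hne : (ρ : ℂ) ≠ w) {z : ℂ} (hz : z ∈ ball w r) :
      0 < ‖z - ρ‖ ∧ 1 + ‖(ρ : ℂ)‖ ≤ A * ‖z - ρ‖ := by
    have h1 := hsep ρ ρ.2 hne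
    rw [mem_ball, dist_eq_norm] at hz
    have h2 : ‖(ρ : ℂ) - w‖ ≤ ‖z - ρ‖ + ‖z - w‖ := by
      rw [norm_sub_rev z ρ]
      calc _ = ‖(ρ - z) + (z - w)‖ := by ring_nf
        _ ≤ _ := norm_add_le _ _
    have h3 : ‖(ρ : ℂ)‖ ≤ ‖(ρ : ℂ) - w‖ + ‖w‖ := by
      simpa using norm_add_le ((ρ : ℂ) - w) w
    have h4 : r ≤ ‖z - ρ‖ := by linarith
    have h5 : 1 + ‖w‖ ≤ (1 + ‖w‖) / r * ‖z - ρ‖ := by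
      rw [div_mul_eq_mul_div, le_div_iff₀ hr]; gcongr
    exact ⟨hr.trans_le h4, by simp only [A]; linarith⟩
  have hbound (ρ : nontrivialZetaZeros) (z : ℂ) (hz : z ∈ ball w r) :
      ‖q ρ z‖ ≤ A ^ 2 * ((zetaZeroMult ρ : ℝ) / (1 + ‖(ρ : ℂ)‖) ^ 2) := by
    simp only [hq]
    split_ifs with h
    · rw [norm_zero]; positivity
    · obtain ⟨h1, h2⟩ := far ρ h hz
      simp only [t, norm_mul, norm_div, norm_pow, norm_one, Complex.norm_natCast]
      rw [mul_one_div, mul_div_assoc', div_le_div_iff₀ (by positivity) (by positivity)]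
      calc (zetaZeroMult ρ : ℝ) * (1 + ‖(ρ : ℂ)‖) ^ 2
          ≤ zetaZeroMult ρ * (A * ‖z - ρ‖) ^ 2 := by gcongr
        _ = _ := by ring
  have hsum := summable_zetaZeroMult_div.mul_left (A ^ 2)
  have hdiff : DifferentiableOn ℂ (fun z ↦ ∑' ρ, q ρ z) (ball w r) := by
    refine differentiableOn_tsum_of_summable_norm hsum (fun ρ z hz ↦ ?_) isOpen_ball hbound
    simp only [hq]
    split_ifs with h
    · exact differentiableWithinAt_const _
    · have hne : (z - ρ) ^ 2 ≠ 0 := pow_ne_zero _ (norm_pos_iff.1 (far ρ h hz).1)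
      have hd : DifferentiableAt ℂ (fun z : ℂ ↦ (z - ρ) ^ 2) z := by fun_prop
      exact (((differentiableAt_const _).div hd hne).const_mul _).differentiableWithinAt
  refine ⟨r, _, hr, hdiff.analyticAt (isOpen_ball.mem_nhds (mem_ball_self hr)), fun z hz ↦ ?_⟩
  have hqs : Summable fun ρ ↦ q ρ z := Summable.of_norm_bounded hsum fun ρ ↦ hbound ρ z hz
  by_cases hw : w ∈ nontrivialZetaZeros
  · have hts : Summable fun ρ ↦ t ρ z := by
      refine (summable_congr_cofinite ?_).1 hqs
      filter_upwards [(finite_singleton (⟨w, hw⟩ : nontrivialZetaZeros)).compl_mem_cofinite]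
        with ρ hρ
      have : (ρ : ℂ) ≠ w := fun h ↦ hρ (Subtype.ext h)
      simp [hq, this]
    refine ⟨hts, ?_⟩
    refine (hts.tsum_eq_add_tsum_ite ⟨w, hw⟩).trans ?_
    congr 1
    refine tsum_congr fun ρ ↦ ?_
    simp [hq, Subtype.ext_iff]
  · have e : ∀ ρ, q ρ z = t ρ z := fun ρ ↦ by
      have : (ρ : ℂ) ≠ w := fun h ↦ hw (h ▸ ρ.2)
      simp [hq, this]
    refine ⟨hqs.congr e, ?_⟩
    rw [zetaZeroMult_eq_zero hw0 hw, Nat.cast_zero, zero_mul, zero_add]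
    exact (tsum_congr e).symm

end LocalSingularities

/-! ### The expansion of the derivative of the logarithmic derivative of zeta -/

section LogDerivExpansion

open Complex Set Filter Topology Metric

lemma entireXi_ne_zero {w : ℂ} (hw : 0 < w.re) (hw' : w ∉ nontrivialZetaZeros) :
    entireXi w ≠ 0 := by
  rcases eq_or_ne w 1 with rfl | h1
  · simp [entireXi_one]
  · intro h
    apply riemannZeta_ne_zero_of_notMem hw hw'
    rw [riemannZeta_eq_entireXi_mul hw h1, h, zero_mul]

lemma analyticOrderAt_entireXi_ne_top (w : ℂ) : analyticOrderAt entireXi w ≠ ⊤ := by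
  have h : AnalyticOnNhd ℂ entireXi univ := fun z _ ↦ differentiable_entireXi.analyticAt z
  refine h.analyticOrderAt_ne_top_of_isPreconnected isPreconnected_univ (mem_univ 0) (mem_univ w) ?_
  rw [(h 0 (mem_univ 0)).analyticOrderAt_eq_zero.2 (by simp [entireXi_zero])]
  simp

lemma analyticAt_deriv_logDeriv {f : ℂ → ℂ} {w : ℂ} (hf : AnalyticAt ℂ f w) (h0 : f w ≠ 0) :
    AnalyticAt ℂ (deriv (logDeriv f)) w :=
  (hf.deriv.div hf h0).deriv

/-- The double poles of `(ξ'/ξ)'` at the zeros cancel against those of the sum over the zeros,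
leaving a function analytic in the right half-plane. -/
lemma exists_zetaZero_free_part : ∃ K : ℂ → ℂ, (∀ w : ℂ, 0 < w.re → AnalyticAt ℂ K w) ∧
    ∀ w : ℂ, 0 < w.re → w ∉ nontrivialZetaZeros →
      K w = deriv (logDeriv entireXi) w + zetaZeroSquareSum w := by
  have hloc : ∀ w ∈ {w : ℂ | 0 < w.re}, ∃ g : ℂ → ℂ, AnalyticAt ℂ g w ∧
      (fun w ↦ deriv (logDeriv entireXi) w + zetaZeroSquareSum w) =ᶠ[𝓝[≠] w] g := by
    intro w hw
    obtain ⟨r, Q, hr, hQ, hQe⟩ := zetaZeroSquareSum_local hw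
    obtain ⟨g, hg, hge⟩ := deriv_logDeriv_of_analyticOrderNatAt
      (differentiable_entireXi.analyticAt w) (analyticOrderAt_entireXi_ne_top w)
    refine ⟨fun z ↦ g z + Q z, hg.add hQ, ?_⟩
    filter_upwards [hge, nhdsWithin_le_nhds (ball_mem_nhds w hr)] with z hz1 hz
    have := (hQe z hz).2
    simp only [hz1, this, zetaZeroMult_eq hw]
    ring
  obtain ⟨K, hK, hKf⟩ := exists_analytic_extension hloc isOpen_re_pos
  refine ⟨K, hK, fun w hw hwZ ↦ hKf w hw ?_⟩
  obtain ⟨r, Q, hr, hQ, hQe⟩ := zetaZeroSquareSum_local hw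
  refine (analyticAt_deriv_logDeriv (differentiable_entireXi.analyticAt w)
    (entireXi_ne_zero hw hwZ)).continuousAt.add (hQ.continuousAt.congr ?_)
  filter_upwards [ball_mem_nhds w hr] with z hz
  have := (hQe z hz).2
  rw [this, zetaZeroMult_eq_zero hw hwZ, Nat.cast_zero, zero_mul, zero_add]

lemma deriv_logDeriv_riemannZeta {w : ℂ} (hw : 0 < w.re) (h1 : w ≠ 1)
    (hwZ : w ∉ nontrivialZetaZeros) :
    deriv (logDeriv riemannZeta) w =
      deriv (logDeriv entireXi) w + deriv (logDeriv xiFactor) w + 1 / (w - 1) ^ 2 := by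
  have hopen : IsOpen ({w : ℂ | 0 < w.re} ∩ {1}ᶜ) := isOpen_re_pos.inter isOpen_compl_singleton
  have hX := differentiable_entireXi.analyticAt w
  have hF := analyticAt_xiFactor hw
  have hev : logDeriv riemannZeta =ᶠ[𝓝 w]
      fun z ↦ logDeriv entireXi z + (logDeriv xiFactor z - 1 / (z - 1)) := by
    filter_upwards [hopen.mem_nhds ⟨hw, h1⟩,
      hX.continuousAt.eventually_ne (entireXi_ne_zero hw hwZ)] with z hz hz0
    obtain ⟨hz, hz1⟩ := hz
    have hz1' : z - 1 ≠ 0 := sub_ne_zero.2 hz1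
    have hd : DifferentiableAt ℂ (fun s : ℂ ↦ s - 1) z := by fun_prop
    have hloc : riemannZeta =ᶠ[𝓝 z] fun s ↦ entireXi s * (xiFactor s / (s - 1)) := by
      filter_upwards [hopen.mem_nhds ⟨hz, hz1⟩] with s hs
      exact riemannZeta_eq_entireXi_mul hs.1 hs.2
    have e : logDeriv riemannZeta z = logDeriv (fun s ↦ entireXi s * (xiFactor s / (s - 1))) z := by
      rw [logDeriv_apply, logDeriv_apply, hloc.deriv_eq, hloc.eq_of_nhds]
    have hFz := analyticAt_xiFactor hz
    rw [e, logDeriv_mul (g := fun s ↦ xiFactor s / (s - 1)) z hz0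
      (div_ne_zero (xiFactor_ne_zero hz) hz1') differentiable_entireXi.differentiableAt
      (hFz.differentiableAt.div hd hz1'),
      logDeriv_div (g := fun s ↦ s - 1) z (xiFactor_ne_zero hz) hz1' hFz.differentiableAt hd]
    congr 2
    rw [logDeriv_apply, deriv_sub_const, deriv_id'']
  have hw1 : w - 1 ≠ 0 := sub_ne_zero.2 h1
  have d1 := (hX.deriv.div hX (entireXi_ne_zero hw hwZ)).differentiableAt.hasDerivAt
  have d2 := (hF.deriv.div hF (xiFactor_ne_zero hw)).differentiableAt.hasDerivAt
  have d3 := (hasDerivAt_const w (1 : ℂ)).div ((hasDerivAt_id w).sub_const 1) hw1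
  rw [hev.deriv_eq]
  refine (d1.add (d2.sub d3)).deriv.trans ?_
  simp only [id, zero_mul, one_mul, zero_sub, logDeriv]
  ring

/-- In the right half-plane `(ζ'/ζ)'` is the contribution of the pole at `1` and of the nontrivial
zeros, up to an analytic function. -/
lemma exists_deriv_logDeriv_riemannZeta_expansion : ∃ E : ℂ → ℂ,
    (∀ w : ℂ, 0 < w.re → AnalyticAt ℂ E w) ∧
    ∀ w : ℂ, 0 < w.re → w ≠ 1 → w ∉ nontrivialZetaZeros →
      deriv (logDeriv riemannZeta) w = 1 / (w - 1) ^ 2 - zetaZeroSquareSum w + E w := by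
  obtain ⟨K, hK, hKe⟩ := exists_zetaZero_free_part
  refine ⟨fun w ↦ K w + deriv (logDeriv xiFactor) w, fun w hw ↦ (hK w hw).add
    (analyticAt_deriv_logDeriv (analyticAt_xiFactor hw) (xiFactor_ne_zero hw)),
    fun w hw h1 hwZ ↦ ?_⟩
  simp only [deriv_logDeriv_riemannZeta hw h1 hwZ, hKe w hw hwZ]
  ring

/-- This holds at the zeros as well, where the one singular summand is `0` by convention. -/
lemma summable_zetaZeroSquareSum {w : ℂ} (hw : 0 < w.re) :
    Summable (fun ρ : nontrivialZetaZeros ↦ (zetaZeroMult ρ : ℂ) * (1 / (w - ρ) ^ 2)) := by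
  obtain ⟨r, Q, hr, -, h⟩ := zetaZeroSquareSum_local hw
  exact (h w (mem_ball_self hr)).1

lemma meromorphicAt_riemannZeta (w : ℂ) : MeromorphicAt riemannZeta w := by
  rcases eq_or_ne w 1 with rfl | h1
  · have ha : MeromorphicAt (fun s ↦ entireXi s * (xiFactor s / (s - 1))) 1 :=
      (differentiable_entireXi.analyticAt 1).meromorphicAt.mul
        ((analyticAt_xiFactor (by simp)).meromorphicAt.div
          (analyticAt_id.sub analyticAt_const).meromorphicAt)
    refine ha.congr ?_
    filter_upwards [self_mem_nhdsWithin,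
      nhdsWithin_le_nhds (isOpen_re_pos.mem_nhds (show 0 < (1 : ℂ).re by simp))] with s hs hs'
    exact (riemannZeta_eq_entireXi_mul hs' hs).symm
  · exact (analyticOn_riemannZeta w h1).meromorphicAt

lemma meromorphicAt_deriv_logDeriv_riemannZeta (w : ℂ) :
    MeromorphicAt (deriv (logDeriv riemannZeta)) w :=
  ((meromorphicAt_riemannZeta w).deriv.div (meromorphicAt_riemannZeta w)).deriv

end LogDerivExpansion

/-! ### The Dirichlet series with coefficients `Λ(n)²` -/

section DirichletSeries

open Complex LSeries ArithmeticFunction Filter Topology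

/-- The coefficients `n ↦ Λ(k) log k` at `n = k ^ 2` and zero at nonsquares, of the Dirichlet series
`∑ Λ(k) log k · k^(-2w)`. Since `Λ(k ^ 2) = Λ(k)`, no square root is needed in the formula. -/
noncomputable def squareCoeff (n : ℕ) : ℝ :=
  open Classical in if IsSquare n then Λ n * (Real.log n / 2) else 0

/-- The coefficients of `∑ Λ(n)² n^(-w) - (ζ'/ζ)'(w) + (ζ'/ζ)'(2w)` as a Dirichlet series. -/
noncomputable def remainderCoeff (n : ℕ) : ℝ :=
  Λ n ^ 2 - Λ n * Real.log n + squareCoeff n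

/-- At `p` and `p ^ 2` the three contributions to the coefficient cancel, so it is supported on
prime powers with exponent at least `3`. -/
lemma exists_eq_pow_of_remainderCoeff_ne_zero {n : ℕ} (h : remainderCoeff n ≠ 0) :
    ∃ a m : ℕ, n = (a + 2) ^ (m + 3) := by
  have hΛ : Λ n ≠ 0 := fun h0 ↦ h (by simp [remainderCoeff, squareCoeff, h0])
  obtain ⟨p, k, hp, hk, rfl⟩ := (isPrimePow_nat_iff n).1 (vonMangoldt_ne_zero_iff.1 hΛ)
  have hk3 : 3 ≤ k := by
    by_contra! hlt
    apply h
    rw [remainderCoeff, squareCoeff, vonMangoldt_apply_pow hk.ne', vonMangoldt_apply_prime hp]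
    interval_cases k
    · rw [if_neg (by simpa using hp.prime.not_isSquare)]; simp [sq]
    · rw [if_pos (IsSquare.sq p)]; push_cast; rw [Real.log_pow]; push_cast; ring
  refine ⟨p - 2, k - 3, ?_⟩
  rw [Nat.sub_add_cancel hp.two_le, Nat.sub_add_cancel hk3]

lemma abs_remainderCoeff_le (n : ℕ) : |remainderCoeff n| ≤ 2 * Real.log n ^ 2 := by
  have h0 : 0 ≤ Λ n := vonMangoldt_nonneg
  have h1 : Λ n ≤ Real.log n := vonMangoldt_le_log
  have h2 : 0 ≤ Λ n * (Real.log n / 2) := by nlinarith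
  rw [remainderCoeff, squareCoeff, abs_le]
  split_ifs <;> constructor <;> nlinarith

lemma summable_perfect_powers {y : ℝ} (hy : 1 / 3 < y) :
    Summable fun x : ℕ × ℕ ↦ (((x.1 + 2) ^ (x.2 + 3) : ℕ) : ℝ) ^ (-y) := by
  set q : ℝ := (2 : ℝ) ^ (-y)
  have hq1 : q < 1 := Real.rpow_lt_one_of_one_lt_of_neg (by norm_num) (by linarith)
  have s1 : Summable fun a : ℕ ↦ ((a + 2 : ℕ) : ℝ) ^ (-(3 * y)) :=
    (summable_nat_add_iff 2).2 (Real.summable_nat_rpow.2 (by linarith))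
  have s2 : Summable fun m : ℕ ↦ q ^ m := summable_geometric_of_lt_one (by positivity) hq1
  refine Summable.of_nonneg_of_le (fun _ ↦ by positivity) (fun x ↦ ?_)
    (s1.mul_of_nonneg s2 (fun _ ↦ by positivity) (fun _ ↦ by positivity))
  obtain ⟨a, m⟩ := x
  have hb : ((a + 2 : ℕ) : ℝ) ^ (-y) ≤ q :=
    Real.rpow_le_rpow_of_nonpos (by norm_num) (by push_cast; linarith [Nat.cast_nonneg (α := ℝ) a])
      (by linarith)
  have e : (((a + 2) ^ (m + 3) : ℕ) : ℝ) ^ (-y) =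
      ((a + 2 : ℕ) : ℝ) ^ (-(3 * y)) * (((a + 2 : ℕ) : ℝ) ^ (-y)) ^ m := by
    have hpos : (0 : ℝ) < ((a + 2 : ℕ) : ℝ) := by positivity
    rw [Nat.cast_pow, ← Real.rpow_natCast, ← Real.rpow_mul hpos.le, ← Real.rpow_natCast _ m,
      ← Real.rpow_mul hpos.le, ← Real.rpow_add hpos]
    congr 1; push_cast; ring
  simp only [e]
  gcongr

lemma LSeriesSummable_remainderCoeff {y : ℝ} (hy : 1 / 3 < y) :
    LSeriesSummable (fun n ↦ (remainderCoeff n : ℂ)) y := by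
  classical
  set T : Set ℕ := {n | ∃ a m : ℕ, n = (a + 2) ^ (m + 3)}
  obtain ⟨x, hx1, hx2⟩ := exists_between hy
  set ε := (y - x) / 2
  have hε : 0 < ε := by simp only [ε]; linarith
  have hT : Summable (T.indicator fun n : ℕ ↦ (n : ℝ) ^ (-x)) := by
    rw [← summable_subtype_iff_indicator]
    -- a point of `T` is determined by its base and exponent, so the sum over `T` is part of the sum
    -- over all pairs
    choose a m ham using fun n : T ↦ n.2
    have hinj : Function.Injective fun n : T ↦ (a n, m n) := fun n k h ↦ by
      obtain ⟨h1, h2⟩ := Prod.ext_iff.1 h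
      simp only at h1 h2
      exact Subtype.ext (by rw [ham n, ham k, h1, h2])
    refine ((summable_perfect_powers hx1).comp_injective hinj).congr fun n ↦ ?_
    simp only [Function.comp_apply, ← ham n]
  refine Summable.of_norm_bounded (hT.mul_left (2 / ε ^ 2)) fun n ↦ ?_
  rw [norm_term_eq]
  split_ifs with hn
  · exact mul_nonneg (by positivity) (Set.indicator_nonneg (fun _ _ ↦ by positivity) _)
  by_cases hc : remainderCoeff n = 0
  · simp only [hc, ofReal_zero, norm_zero, zero_div]
    exact mul_nonneg (by positivity) (Set.indicator_nonneg (fun _ _ ↦ by positivity) _)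
  rw [Set.indicator_of_mem (s := T) (exists_eq_pow_of_remainderCoeff_ne_zero hc), norm_real,
    Real.norm_eq_abs, ofReal_re]
  have hn0 : (0 : ℝ) < n := by positivity
  have hlog : Real.log n ^ 2 ≤ ((n : ℝ) ^ ε / ε) ^ 2 :=
    pow_le_pow_left₀ (Real.log_natCast_nonneg n) (Real.log_natCast_le_rpow_div n hε) 2
  rw [div_le_iff₀ (by positivity)]
  have e : (n : ℝ) ^ (-x) * (n : ℝ) ^ y = ((n : ℝ) ^ ε) ^ 2 := by
    rw [← Real.rpow_add hn0, ← Real.rpow_natCast, ← Real.rpow_mul hn0.le]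
    congr 1; simp only [ε]; push_cast; ring
  calc _ ≤ 2 * Real.log n ^ 2 := abs_remainderCoeff_le n
    _ ≤ 2 * ((n : ℝ) ^ ε / ε) ^ 2 := by gcongr
    _ = 2 / ε ^ 2 * ((n : ℝ) ^ ε) ^ 2 := by rw [div_pow]; field_simp
    _ = _ := by rw [← e]; ring

lemma abscissaOfAbsConv_remainderCoeff_le :
    abscissaOfAbsConv (fun n ↦ (remainderCoeff n : ℂ)) ≤ ((1 / 3 : ℝ) : EReal) :=
  abscissaOfAbsConv_le_of_forall_lt_LSeriesSummable fun _ hy ↦ LSeriesSummable_remainderCoeff hy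

lemma abscissaOfAbsConv_vonMangoldt_le :
    abscissaOfAbsConv (fun n ↦ (Λ n : ℂ)) ≤ ((1 : ℝ) : EReal) :=
  abscissaOfAbsConv_le_of_forall_lt_LSeriesSummable fun _ hy ↦
    LSeriesSummable_vonMangoldt (by simpa using hy)

lemma LSeriesSummable_logMul_vonMangoldt {w : ℂ} (hw : 1 < w.re) :
    LSeriesSummable (logMul fun n ↦ (Λ n : ℂ)) w :=
  LSeriesSummable_logMul_of_lt_re (abscissaOfAbsConv_vonMangoldt_le.trans_lt (mod_cast hw))

lemma deriv_logDeriv_riemannZeta_eq_LSeries {w : ℂ} (hw : 1 < w.re) :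
    deriv (logDeriv riemannZeta) w = LSeries (logMul fun n ↦ (Λ n : ℂ)) w := by
  have hev : logDeriv riemannZeta =ᶠ[𝓝 w] fun z ↦ -LSeries (fun n ↦ (Λ n : ℂ)) z := by
    filter_upwards [(isOpen_lt continuous_const continuous_re).mem_nhds hw] with z hz
    rw [LSeries_vonMangoldt_eq_deriv_riemannZeta_div hz, logDeriv_apply]
    ring
  rw [hev.deriv_eq, deriv.fun_neg,
    LSeries_deriv (abscissaOfAbsConv_vonMangoldt_le.trans_lt (mod_cast hw)), neg_neg]

lemma LSeriesHasSum_squareCoeff {w : ℂ} (hw : 1 / 2 < w.re) :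
    LSeriesHasSum (fun n ↦ (squareCoeff n : ℂ)) w
      (LSeries (logMul fun n ↦ (Λ n : ℂ)) (2 * w)) := by
  have hs := (LSeriesSummable_logMul_vonMangoldt (w := 2 * w) (by simp; linarith)).LSeriesHasSum
  have hinj : Function.Injective fun n : ℕ ↦ n ^ 2 := Nat.pow_left_injective two_ne_zero
  refine (hinj.hasSum_iff fun n hn ↦ ?_).1 (hs.congr_fun fun n ↦ ?_)
  · have : ¬ IsSquare n := fun ⟨r, hr⟩ ↦ hn ⟨r, by simp [hr, sq]⟩
    simp [term_def, squareCoeff, this]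
  · rcases eq_or_ne n 0 with rfl | hn
    · simp
    · have hn' : n ^ 2 ≠ 0 := pow_ne_zero 2 hn
      simp only [Function.comp_apply]
      rw [term_of_ne_zero hn, term_of_ne_zero hn', squareCoeff, if_pos (IsSquare.sq n),
        vonMangoldt_apply_pow two_ne_zero, logMul, Nat.cast_pow, Nat.cast_pow, Real.log_pow,
        ← Complex.natCast_log]
      have e : ((n : ℂ) ^ 2) ^ w = (n : ℂ) ^ (2 * w) := by
        rw [sq, natCast_mul_natCast_cpow, ← cpow_add _ _ (by exact_mod_cast hn), two_mul]
      rw [e]; push_cast; ring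

lemma vonMangoldtSqTerm_eq (s : ℂ) :
    vonMangoldtSqTerm s = term (fun n ↦ ((Λ n ^ 2 : ℝ) : ℂ)) (2 * s) := by
  funext n
  rcases eq_or_ne n 0 with rfl | hn
  · simp [vonMangoldtSqTerm]
  · rw [term_of_ne_zero hn, vonMangoldtSqTerm]; push_cast; rfl

lemma vonMangoldtSq_hasSum {s : ℂ} (hs : 1 / 2 < s.re) :
    HasSum (vonMangoldtSqTerm s) (deriv (logDeriv riemannZeta) (2 * s) -
      deriv (logDeriv riemannZeta) (4 * s) + LSeries (fun n ↦ (remainderCoeff n : ℂ)) (2 * s)) := by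
  have h2 : 1 < (2 * s).re := by simp; linarith
  have h4 : 1 < (4 * s).re := by simp; linarith
  have hA := (LSeriesSummable_logMul_vonMangoldt h2).LSeriesHasSum
  have hB := LSeriesHasSum_squareCoeff (w := 2 * s) (by linarith)
  have hC := (LSeriesSummable_of_abscissaOfAbsConv_lt_re
    (abscissaOfAbsConv_remainderCoeff_le.trans_lt (b := ((1 / 3 : ℝ) : EReal)) (c := (2 * s).re)
      (mod_cast (by linarith)))).LSeriesHasSum
  rw [deriv_logDeriv_riemannZeta_eq_LSeries h2, deriv_logDeriv_riemannZeta_eq_LSeries h4,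
    vonMangoldtSqTerm_eq, show 4 * s = 2 * (2 * s) by ring]
  refine ((hA.sub hB).add hC).congr_fun fun n ↦ ?_
  rcases eq_or_ne n 0 with rfl | hn
  · simp
  · rw [term_of_ne_zero hn, term_of_ne_zero hn, Pi.add_apply, Pi.sub_apply,
      remainderCoeff, logMul, ← Complex.natCast_log]
    push_cast; ring

end DirichletSeries

/-! ### The continuation -/

open Complex Set Filter Topology LSeries

theorem lemma2p1 :
    ∃ H₀ H₁ D : ℂ → ℂ,
      DifferentiableOn ℂ H₀ {s : ℂ | 1 / 6 < s.re} ∧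
      DifferentiableOn ℂ H₁ {s : ℂ | 1 / 6 < s.re} ∧
      MeromorphicOn D {s : ℂ | 1 / 6 < s.re} ∧
      (∀ s : ℂ, 1 / 2 < s.re →
        Summable (vonMangoldtSqTerm s) ∧
        vonMangoldtSqSeries s =
          1 / 2 * deriv (fun w : ℂ =>
              deriv riemannZeta (2 * w) / riemannZeta (2 * w)
                - 1 / 2 * (deriv riemannZeta (4 * w) / riemannZeta (4 * w))) s
            + H₀ s) ∧
      (∀ s : ℂ, 1 / 2 < s.re → D s = vonMangoldtSqSeries s) ∧
      (∀ s : ℂ, 1 / 6 < s.re → s ≠ 1 / 2 → s ≠ 1 / 4 →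
        (∀ ρ ∈ nontrivialZetaZeros, 2 * s ≠ ρ ∧ 4 * s ≠ ρ) →
        AnalyticAt ℂ D s ∧
        Summable (zetaZeroTerm s) ∧
        D s = 1 / (2 * s - 1) ^ 2 - 1 / (4 * s - 1) ^ 2
            - ∑' ρ : nontrivialZetaZeros, zetaZeroTerm s ρ + H₁ s) := by
  obtain ⟨E, hE, hEe⟩ := exists_deriv_logDeriv_riemannZeta_expansion
  set G : ℂ → ℂ := deriv (logDeriv riemannZeta) with hG
  set H₀ : ℂ → ℂ := fun s ↦ LSeries (fun n ↦ (remainderCoeff n : ℂ)) (2 * s) with hH₀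
  have lin (c s : ℂ) : AnalyticAt ℂ (fun w : ℂ ↦ c * w) s := analyticAt_const.mul analyticAt_id
  have re2 {s : ℂ} (hs : 1 / 6 < s.re) : 1 / 3 < (2 * s).re := by simp; linarith
  have re4 {s : ℂ} (hs : 1 / 6 < s.re) : 2 / 3 < (4 * s).re := by simp; linarith
  have hH₀an {s : ℂ} (hs : 1 / 6 < s.re) : AnalyticAt ℂ H₀ s := by
    refine AnalyticAt.fun_comp (g := LSeries fun n ↦ (remainderCoeff n : ℂ)) ?_ (lin 2 s)
    exact LSeries_analyticOnNhd _ (2 * s)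
      (abscissaOfAbsConv_remainderCoeff_le.trans_lt (EReal.coe_lt_coe_iff.2 (re2 hs)))
  have hGan {w : ℂ} (hw : 0 < w.re) (h1 : w ≠ 1) (hwZ : w ∉ nontrivialZetaZeros) :
      AnalyticAt ℂ G w :=
    analyticAt_deriv_logDeriv (analyticOn_riemannZeta w h1) (riemannZeta_ne_zero_of_notMem hw hwZ)
  refine ⟨H₀, fun s ↦ E (2 * s) - E (4 * s) + H₀ s, fun s ↦ G (2 * s) - G (4 * s) + H₀ s,
    fun s hs ↦ (hH₀an hs).differentiableAt.differentiableWithinAt, fun s hs ↦ ?_, fun s hs ↦ ?_,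
    fun s hs ↦ ?_, fun s hs ↦ (vonMangoldtSq_hasSum hs).tsum_eq.symm, fun s hs h2 h4 hρ ↦ ?_⟩
  · refine (AnalyticAt.add (AnalyticAt.sub ?_ ?_) (hH₀an
      hs)).differentiableAt.differentiableWithinAt
    · exact (hE (2 * s) (by linarith [re2 hs])).fun_comp (lin 2 s)
    · exact (hE (4 * s) (by linarith [re4 hs])).fun_comp (lin 4 s)
  · refine MeromorphicAt.add (MeromorphicAt.sub ?_ ?_) (hH₀an hs).meromorphicAt
    · exact (meromorphicAt_deriv_logDeriv_riemannZeta (2 * s)).comp_analyticAt (lin 2 s)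
    · exact (meromorphicAt_deriv_logDeriv_riemannZeta (4 * s)).comp_analyticAt (lin 4 s)
  · refine ⟨(vonMangoldtSq_hasSum hs).summable, (vonMangoldtSq_hasSum hs).tsum_eq.trans ?_⟩
    -- for `Re w > 1` the logarithmic derivative of `ζ` is analytic, so the chain rule applies
    have hL {w : ℂ} (hw : 1 < w.re) : HasDerivAt (logDeriv riemannZeta) (G w) w := by
      have h1 : w ≠ 1 := fun h ↦ by simp [h] at hw
      have hz := analyticOn_riemannZeta w h1
      exact (hz.deriv.div hz (riemannZeta_ne_zero_of_one_le_re hw.le)).differentiableAt.hasDerivAt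
    have d (c : ℂ) (hc : 1 < (c * s).re) :
        HasDerivAt (fun w ↦ logDeriv riemannZeta (c * w)) (G (c * s) * c) s := by
      have hm : HasDerivAt (fun w : ℂ ↦ c * w) c s := by
        simpa using (hasDerivAt_id s).const_mul c
      exact (hL hc).comp s hm
    have hd := ((d 2 (by simp; linarith)).sub
      ((d 4 (by simp; linarith)).const_mul (1 / 2))).deriv
    rw [show deriv (fun w : ℂ => deriv riemannZeta (2 * w) / riemannZeta (2 * w)
        - 1 / 2 * (deriv riemannZeta (4 * w) / riemannZeta (4 * w))) s = _ from hd]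
    simp only [hH₀]
    ring
  · have p2 : 0 < (2 * s).re := by linarith [re2 hs]
    have p4 : 0 < (4 * s).re := by linarith [re4 hs]
    have n2 : 2 * s ≠ 1 := fun h ↦ h2 (by linear_combination h / 2)
    have n4 : 4 * s ≠ 1 := fun h ↦ h4 (by linear_combination h / 4)
    have z2 : 2 * s ∉ nontrivialZetaZeros := fun h ↦ (hρ _ h).1 rfl
    have z4 : 4 * s ∉ nontrivialZetaZeros := fun h ↦ (hρ _ h).2 rfl
    have hs2 := summable_zetaZeroSquareSum p2
    have hs4 := summable_zetaZeroSquareSum p4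
    have ht : zetaZeroTerm s = fun ρ : nontrivialZetaZeros ↦
        (zetaZeroMult ρ : ℂ) * (1 / (2 * s - ρ) ^ 2) -
          (zetaZeroMult ρ : ℂ) * (1 / (4 * s - ρ) ^ 2) := by
      funext ρ; rw [zetaZeroTerm, mul_sub]
    refine ⟨((AnalyticAt.fun_comp (hGan p2 n2 z2) (lin 2 s)).sub
      (AnalyticAt.fun_comp (hGan p4 n4 z4) (lin 4 s))).add (hH₀an hs), ht ▸ hs2.sub hs4, ?_⟩
    have e : ∑' ρ : nontrivialZetaZeros, zetaZeroTerm s ρ =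
        zetaZeroSquareSum (2 * s) - zetaZeroSquareSum (4 * s) := by
      rw [ht]; exact hs2.tsum_sub hs4
    simp only [e, hEe _ p2 n2 z2, hEe _ p4 n4 z4]
    ring
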